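/- Let $\langle\cdot,\cdot\rangle$ and $\|\cdot\|$ be the inner product and norm of the real space $L^2(0,1)$, let $H^1(0,1)$ carry the norm $\|u\|_{H^1(0,1)}=(\|u\|^2+\|\partial_y u\|^2)^{1/2}$, let $H^1_0(0,1)$ be the closure of $C_c^\infty(0,1)$ in $H^1(0,1)$ and $H^{-1}(0,1)$ its dual, in which $L^2(0,1)$ is embedded by $f\mapsto\langle f,\cdot\rangle$. Let $\beta(\varepsilon)\in(0,1)$ for $\varepsilon\in(0,1)$, with $\beta(\varepsilon)\to0$ as $\varepsilon\to0^+$, and let $\gamma:(0,1)\to[1,\infty)$ satisfy $\gamma(b)\to\infty$ as $b\to0^+$. Let $C_1>0$ be independent of $\varepsilon$, and for each $\varepsilon\in(0,1)$ let $\mathbf P_\varepsilon:H^1(0,1)\to L^2(0,1)$ be a linear map with $$\|\mathbf P_\varepsilon u\|\le C_1\log\big(\gamma(\beta(\varepsilon))\big)\,\|u\|_{H^1(0,1)}\qquad\text{for all }u\in H^1(0,1).$$ Let $u_0\in H^1(0,1)$ and, for each $\varepsilon\in(0,1)$, let $u_0^\varepsilon\in H^1_0(0,1)$ satisfy $\|u_0^\varepsilon-u_0\|_{H^1(0,1)}\le\varepsilon$.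 **Theorem 3.3.** For each noise level $\varepsilon\in(0,1)$ the regularized problem $$u_{xx}-u_{yy}+\mathbf P_\varepsilon u=0\ \text{ in }(0,1)\times(0,1),\qquad u(x,0)=u(x,1)=0,\qquad u(0,\cdot)=u_0^\varepsilon,\quad u_x(0,\cdot)=0,$$ has a weak solution, that is, a function $u:[0,1]\to H^1_0(0,1)$ such that * $u\in C([0,1];H^1_0(0,1))$, $\partial_xu\in C([0,1];L^2(0,1))$ and $\partial_x^2u\in L^2(0,1;H^{-1}(0,1))$, where $\partial_xu$ is the derivative of $u$ as an $L^2(0,1)$-valued function and $\partial_x^2u$ is the weak derivative of $\partial_xu$ as an $H^{-1}(0,1)$-valued function; * for every $\psi\in H^1_0(0,1)$ and almost every $x\in(0,1)$, $$\langle\partial_x^2u(x),\psi\rangle+\langle\partial_yu(x),\partial_y\psi\rangle+\langle\mathbf P_\varepsilon u(x),\psi\rangle=0,$$ where the first bracket is the pairing of $H^{-1}(0,1)$ with $H_0^1(0,1)$; * $u(0)=u_0^\varepsilon$ and $\partial_xu(0)=0$. -/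

import Mathlib

open Set Filter Topology MeasureTheory
open scoped ContDiff

noncomputable section

namespace QuasiReversibility

/-- Test functions on `(0,1)`: smooth real functions with compact support contained in `(0,1)`. -/
structure IsTest (φ : ℝ → ℝ) : Prop where
  smooth : ContDiff ℝ ∞ φ
  compact : HasCompactSupport φ
  supp : tsupport φ ⊆ Ioo (0 : ℝ) 1

/-- `g` is the weak (distributional) derivative of `f` on `(0,1)`, for functions with values in a
real normed space: `∫ φ' f = - ∫ φ g` for every test function `φ`. It is only applied to functions
that are integrable on `(0,1)`. -/
def HasWeakDeriv {X : Type*} [NormedAddCommGroup X] [NormedSpace ℝ X] (f g : ℝ → X) : Prop :=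
  ∀ φ : ℝ → ℝ, IsTest φ →
    ∫ t in Ioo (0 : ℝ) 1, deriv φ t • f t = - ∫ t in Ioo (0 : ℝ) 1, φ t • g t

/-- The real Hilbert space `L²(0,1)`. -/
abbrev L2 : Type := Lp ℝ 2 (volume.restrict (Ioo (0 : ℝ) 1))

lemma integrable_smul_L2 {φ : ℝ → ℝ} (hc : Continuous φ) (hs : HasCompactSupport φ) (f : L2) :
    Integrable (fun t => φ t • f t) (volume.restrict (Ioo (0 : ℝ) 1)) := by
  obtain ⟨C, hC⟩ := hs.exists_bound_of_continuous hc
  exact ((Lp.memLp f).integrable (by norm_num)).bdd_smul C hc.aestronglyMeasurable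
    (Eventually.of_forall hC)

lemma HasWeakDeriv.add_L2 {f f' g g' : L2} (h : HasWeakDeriv (f : ℝ → ℝ) g)
    (h' : HasWeakDeriv (f' : ℝ → ℝ) g') :
    HasWeakDeriv ((f + f' : L2) : ℝ → ℝ) ((g + g' : L2) : ℝ → ℝ) := by
  intro φ hφ
  have hd : Continuous (deriv φ) := hφ.smooth.continuous_deriv (by simp)
  have e1 : (fun t => deriv φ t • (f + f' : L2) t) =ᵐ[volume.restrict (Ioo (0 : ℝ) 1)]
      fun t => deriv φ t • f t + deriv φ t • f' t := by
    filter_upwards [Lp.coeFn_add f f'] with t ht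
    rw [ht, Pi.add_apply, smul_add]
  have e2 : (fun t => φ t • (g + g' : L2) t) =ᵐ[volume.restrict (Ioo (0 : ℝ) 1)]
      fun t => φ t • g t + φ t • g' t := by
    filter_upwards [Lp.coeFn_add g g'] with t ht
    rw [ht, Pi.add_apply, smul_add]
  rw [integral_congr_ae e1, integral_congr_ae e2,
    integral_add (integrable_smul_L2 hd hφ.compact.deriv f)
      (integrable_smul_L2 hd hφ.compact.deriv f'),
    integral_add (integrable_smul_L2 hφ.smooth.continuous hφ.compact g)
      (integrable_smul_L2 hφ.smooth.continuous hφ.compact g'), h φ hφ, h' φ hφ]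
  ring

lemma HasWeakDeriv.smul_L2 (c : ℝ) {f g : L2} (h : HasWeakDeriv (f : ℝ → ℝ) g) :
    HasWeakDeriv ((c • f : L2) : ℝ → ℝ) ((c • g : L2) : ℝ → ℝ) := by
  intro φ hφ
  have e1 : (fun t => deriv φ t • (c • f : L2) t) =ᵐ[volume.restrict (Ioo (0 : ℝ) 1)]
      fun t => c • (deriv φ t • f t) := by
    filter_upwards [Lp.coeFn_smul c f] with t ht
    rw [ht, Pi.smul_apply, smul_comm]
  have e2 : (fun t => φ t • (c • g : L2) t) =ᵐ[volume.restrict (Ioo (0 : ℝ) 1)]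
      fun t => c • (φ t • g t) := by
    filter_upwards [Lp.coeFn_smul c g] with t ht
    rw [ht, Pi.smul_apply, smul_comm]
  rw [integral_congr_ae e1, integral_congr_ae e2, integral_smul, integral_smul, h φ hφ, smul_neg]

lemma hasWeakDeriv_zero_L2 : HasWeakDeriv ((0 : L2) : ℝ → ℝ) ((0 : L2) : ℝ → ℝ) := by
  simpa using HasWeakDeriv.smul_L2 (f := 0) (g := 0) 0 (by
    intro φ _
    have e : ∀ θ : ℝ → ℝ, (fun t => θ t • (0 : L2) t) =ᵐ[volume.restrict (Ioo (0 : ℝ) 1)]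
        fun _ => (0 : ℝ) := fun θ => by
      filter_upwards [Lp.coeFn_zero ℝ 2 (volume.restrict (Ioo (0 : ℝ) 1))] with t ht
      rw [ht, Pi.zero_apply, smul_zero]
    rw [integral_congr_ae (e _), integral_congr_ae (e _)]
    simp)

/-- The Sobolev space `H¹(0,1)`: the pairs `(f, f')` with `f ∈ L²(0,1)` whose weak derivative `f'`
is in `L²(0,1)`, with the norm `(‖f‖² + ‖f'‖²)^(1/2)` and the corresponding inner product. The
second component is determined by the first. -/
def H1 : Submodule ℝ (WithLp 2 (L2 × L2)) where
  carrier := {u | HasWeakDeriv (u.fst : ℝ → ℝ) (u.snd : ℝ → ℝ)}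
  add_mem' := fun h h' => h.add_L2 h'
  zero_mem' := hasWeakDeriv_zero_L2
  smul_mem' := fun c _ h => h.smul_L2 c

/-- The elements of `H¹(0,1)` that are (almost everywhere equal to) test functions. -/
def testSubmodule : Submodule ℝ H1 where
  carrier := {u | ∃ φ : ℝ → ℝ, IsTest φ ∧
    (u.1.fst : ℝ → ℝ) =ᵐ[volume.restrict (Ioo (0 : ℝ) 1)] φ}
  add_mem' := by
    rintro u v ⟨φ, hφ, hu⟩ ⟨ψ, hψ, hv⟩
    refine ⟨φ + ψ, ⟨hφ.smooth.add hψ.smooth, hφ.compact.add hψ.compact, ?_⟩, ?_⟩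
    · exact (tsupport_add φ ψ).trans (union_subset hφ.supp hψ.supp)
    · exact (Lp.coeFn_add u.1.fst v.1.fst).trans (hu.add hv)
  zero_mem' := by
    refine ⟨0, ⟨contDiff_const, HasCompactSupport.zero, ?_⟩, ?_⟩
    · simp [tsupport]
    · exact Lp.coeFn_zero ℝ 2 _
  smul_mem' := by
    rintro c u ⟨φ, hφ, hu⟩
    refine ⟨c • φ, ⟨hφ.smooth.const_smul c, hφ.compact.smul_left (f := fun _ => c), ?_⟩, ?_⟩
    · exact (tsupport_smul_subset_right (fun _ => c) φ).trans hφ.supp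
    · exact (Lp.coeFn_smul c u.1.fst).trans (hu.const_smul c)

/-- `H¹₀(0,1)`: the closure of the test functions in `H¹(0,1)`. -/
def H10 : Submodule ℝ H1 := testSubmodule.topologicalClosure

/-- The inclusion `H¹₀(0,1) → L²(0,1)`. -/
def toL2 : H10 →L[ℝ] L2 :=
  (WithLp.fstL 2 ℝ L2 L2).comp (H1.subtypeL.comp H10.subtypeL)

/-- The weak derivative `∂_y : H¹₀(0,1) → L²(0,1)`. -/
def dy : H10 →L[ℝ] L2 :=
  (WithLp.sndL 2 ℝ L2 L2).comp (H1.subtypeL.comp H10.subtypeL)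

/-- `H⁻¹(0,1)`, the space of continuous linear functionals on `H¹₀(0,1)`. -/
abbrev Hneg1 : Type := StrongDual ℝ H10

/-- The embedding `L²(0,1) → H⁻¹(0,1)`, which sends `f` to `ψ ↦ ⟨f, ψ⟩`. -/
def L2toHneg1 (f : L2) : Hneg1 := (innerSL ℝ f).comp toL2

/-- The conditional estimate of a stabilized operator `P : H¹(0,1) → L²(0,1)` with constant `C₁`,
where `g` is the value of the auxiliary function `γ` at the regularization parameter. -/
def IsStabilized (C₁ g : ℝ) (P : H1 →ₗ[ℝ] L2) : Prop :=
  ∀ u : H1, ‖P u‖ ≤ C₁ * Real.log g * ‖u‖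

/-- `v` is the continuous derivative `∂_x u ∈ C([0,1]; L²(0,1))` of `u : [0,1] → H¹₀(0,1)`, where
`u` is differentiated as a function with values in `L²(0,1)` (one-sided at `0` and `1`). -/
def IsDx (u : ℝ → H10) (v : ℝ → L2) : Prop :=
  ContinuousOn v (Icc 0 1) ∧
    ∀ x ∈ Icc (0 : ℝ) 1, HasDerivWithinAt (fun s => toL2 (u s)) (v x) (Icc 0 1) x

/-- `u : [0,1] → H¹₀(0,1)` is a weak solution of `u_xx - u_yy + P u = 0` in `(0,1) × (0,1)` with
`u(x,0) = u(x,1) = 0`, `u(0,·) = u₀` and `u_x(0,·) = 0`. Here `v = u_x` and `w = u_xx`; only the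
values of `u` and `v` on `[0,1]` and those of `w` on `(0,1)` matter. -/
def IsWeakSolution (P : H1 →ₗ[ℝ] L2) (u₀ : H1) (u : ℝ → H10) : Prop :=
  ContinuousOn u (Icc 0 1) ∧
  ∃ (v : ℝ → L2) (w : ℝ → Hneg1),
    IsDx u v ∧
    MemLp w 2 (volume.restrict (Ioo (0 : ℝ) 1)) ∧
    HasWeakDeriv (fun x => L2toHneg1 (v x)) w ∧
    (∀ ψ : H10, ∀ᵐ x ∂(volume.restrict (Ioo (0 : ℝ) 1)),
      w x ψ + inner ℝ (dy (u x)) (dy ψ) + inner ℝ (P (u x)) (toL2 ψ) = 0) ∧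
    (u 0 : H1) = u₀ ∧
    v 0 = 0

end QuasiReversibility

end

namespace QuasiReversibility

/-! ### Contraction semigroups generated through a bounded inverse. -/

section Semigroup

variable {X : Type*} [NormedAddCommGroup X] [InnerProductSpace ℝ X] [CompleteSpace X]

/-! For fixed `ε` the stabilization estimate makes `P ε` bounded, so the problem is a bounded
perturbation of the wave equation. On `V × H`, with `V = H10` and `H = L2`, it reads `U' = (K⁻¹ + F)
U`, where `K` is bounded and skew, and inverts the wave generator. Unbounded operators are avoided
by multiplying by inverses: the equation solved is `(K U)' = U + K F U`. With `r > ‖F‖`, the shifted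
generator `K⁻¹ + F - r` is dissipative and has a bounded inverse `L`.
`exists_hasDerivWithinAt_of_dissipative` solves `(L S)' = S` by Yosida approximation, and `U = exp
(r t) S` undoes the shift (`exists_hasDerivWithinAt_of_skew`). The components of `U` are `u` and
`u_x`; `exists_wave_solution` reads the second-order equation in the dual of `V`. It remains to
check that `H10` is complete and embeds injectively and densely in `L2`. -/

lemma hasDerivAt_exp_smul_apply (A : X →L[ℝ] X) (x : X) (t : ℝ) :
    HasDerivAt (fun s : ℝ => NormedSpace.exp (s • A) x) (A (NormedSpace.exp (t • A) x)) t := by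
  simpa using (hasDerivAt_exp_smul_const' A t).clm_apply (hasDerivAt_const t x)

lemma continuous_exp_smul_apply (A : X →L[ℝ] X) (x : X) :
    Continuous fun s : ℝ => NormedSpace.exp (s • A) x :=
  continuous_iff_continuousAt.2 fun t => (hasDerivAt_exp_smul_apply A x t).continuousAt

/-- The exponential of a bounded dissipative operator is a contraction. -/
lemma norm_exp_smul_apply_le {A : X →L[ℝ] X} (hA : ∀ x, inner ℝ (A x) x ≤ 0) (x : X) {t : ℝ}
    (ht : 0 ≤ t) : ‖NormedSpace.exp (t • A) x‖ ≤ ‖x‖ := by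
  have hd : ∀ s, HasDerivAt (fun s : ℝ => ‖NormedSpace.exp (s • A) x‖ ^ 2)
      (2 * inner ℝ (NormedSpace.exp (s • A) x) (A (NormedSpace.exp (s • A) x))) s :=
    fun s => (hasDerivAt_exp_smul_apply A x s).norm_sq
  have hanti : Antitone fun s : ℝ => ‖NormedSpace.exp (s • A) x‖ ^ 2 := by
    refine antitone_of_hasDerivAt_nonpos hd fun s => ?_
    have := hA (NormedSpace.exp (s • A) x)
    rw [real_inner_comm] at this
    simp only [Pi.zero_apply]
    linarith
  have h := hanti ht
  simp only [zero_smul, NormedSpace.exp_zero, one_apply_eq_self] at h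
  exact le_of_sq_le_sq h (norm_nonneg _)

/-- The path `s ↦ exp ((t - s) A) exp (s B) x` joins the two vectors. By commutation its derivative
is two contractions applied to `B x - A x`. -/
lemma norm_exp_smul_sub_exp_smul_apply_le {A B : X →L[ℝ] X} (hA : ∀ x, inner ℝ (A x) x ≤ 0)
    (hB : ∀ x, inner ℝ (B x) x ≤ 0) (hAB : Commute A B) (x : X) {t : ℝ} (ht : 0 ≤ t) :
    ‖NormedSpace.exp (t • B) x - NormedSpace.exp (t • A) x‖ ≤ ‖B x - A x‖ * t := by
  have hcomm : ∀ s : ℝ, ∀ y, A (NormedSpace.exp (s • B) y) = NormedSpace.exp (s • B) (A y) := by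
    intro s y
    have : Commute A (NormedSpace.exp (s • B)) := (hAB.smul_right s).exp_right
    exact DFunLike.congr_fun this.eq y
  have hcommB : ∀ s : ℝ, ∀ y, B (NormedSpace.exp (s • B) y) = NormedSpace.exp (s • B) (B y) := by
    intro s y
    have : Commute B (NormedSpace.exp (s • B)) := ((Commute.refl B).smul_right s).exp_right
    exact DFunLike.congr_fun this.eq y
  have hd : ∀ s, HasDerivAt
      (fun s : ℝ => NormedSpace.exp ((t - s) • A) (NormedSpace.exp (s • B) x))
      (NormedSpace.exp ((t - s) • A) (NormedSpace.exp (s • B) (B x - A x))) s := by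
    intro s
    have h1 : HasDerivAt (fun s : ℝ => NormedSpace.exp ((t - s) • A))
        (-(NormedSpace.exp ((t - s) • A) * A)) s := by
      have := (hasDerivAt_exp_smul_const A (t - s)).scomp s ((hasDerivAt_id s).const_sub t)
      rwa [neg_one_smul] at this
    convert h1.clm_apply (hasDerivAt_exp_smul_apply B x s) using 1
    simp [hcomm, hcommB, sub_eq_neg_add]
  have := norm_image_sub_le_of_norm_deriv_le_segment' (a := 0) (b := t) (C := ‖B x - A x‖)
    (fun s _ => (hd s).hasDerivWithinAt) (fun s hs =>
      (norm_exp_smul_apply_le hA _ (sub_nonneg.2 hs.2.le)).trans (norm_exp_smul_apply_le hB _ hs.1))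
    t ⟨ht, le_rfl⟩
  simpa using this

/-- The Lumer–Phillips theorem on `[0,1]`, in terms of the bounded inverse `L` of the generator:
`S` solves `(L S)' = S` with `S 0 = x`. -/
theorem exists_hasDerivWithinAt_of_dissipative (L : X →L[ℝ] X) (hL : ∀ x, inner ℝ (L x) x ≤ 0)
    (hd : DenseRange L) (x : X) : ∃ S : ℝ → X, ContinuousOn S (Icc 0 1) ∧ S 0 = x ∧
      ∀ t ∈ Icc (0 : ℝ) 1, HasDerivWithinAt (fun s => L (S s)) (S t) (Icc 0 1) t := by
  let δ : ℕ → ℝ := fun n => 1 / ((n : ℝ) + 1)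
  have hδ : ∀ n, 0 < δ n := fun n => Nat.one_div_pos_of_nat
  have hδlim : Tendsto δ atTop (𝓝 0) := tendsto_one_div_add_atTop_nhds_zero_nat
  have hco : ∀ n y, δ n * ‖y‖ ^ 2 ≤ -inner ℝ ((L - δ n • 1) y) y := by
    intro n y
    have := hL y
    simp only [sub_apply, smul_apply,
      one_apply_eq_self, inner_sub_left, real_inner_smul_left,
      real_inner_self_eq_norm_sq]
    linarith
  have hunit : ∀ n, IsUnit (L - δ n • (1 : X →L[ℝ] X)) := by
    intro n
    refine ContinuousLinearMap.isUnit_of_forall_le_norm_inner_map _ (c := ⟨δ n, (hδ n).le⟩) (hδ n)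
      fun y => ?_
    rw [mul_comm]
    exact (hco n y).trans (neg_le_abs _)
  choose T hT using hunit
  -- `G n = (L - δ n)⁻¹` is the Yosida approximation of the generator `L⁻¹`.
  let G : ℕ → X →L[ℝ] X := fun n => ((T n)⁻¹ : (X →L[ℝ] X)ˣ)
  have hGT : ∀ n y, (L - δ n • (1 : X →L[ℝ] X)) (G n y) = y := by
    intro n y
    rw [← hT n]
    exact DFunLike.congr_fun (T n).mul_inv y
  have hLG : ∀ n y, L (G n y) = y + δ n • G n y := by
    intro n y
    have := hGT n y
    simp only [sub_apply, smul_apply,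
      one_apply_eq_self] at this
    rw [← sub_eq_iff_eq_add]
    exact this
  have hGdiss : ∀ n y, inner ℝ (G n y) y ≤ 0 := by
    intro n y
    have := hco n (G n y)
    rw [hGT, real_inner_comm] at this
    nlinarith [hδ n, sq_nonneg ‖G n y‖]
  have hGnorm : ∀ n y, ‖δ n • G n y‖ ≤ ‖y‖ := by
    intro n y
    have h1 := hco n (G n y)
    rw [hGT] at h1
    have h2 := (h1.trans (neg_le_abs _)).trans (abs_real_inner_le_norm y (G n y))
    rw [norm_smul, Real.norm_of_nonneg (hδ n).le]
    by_cases h0 : ‖G n y‖ = 0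
    · simp [h0]
    · have : 0 < ‖G n y‖ := lt_of_le_of_ne (norm_nonneg _) (Ne.symm h0)
      nlinarith
  have hcL : ∀ n, Commute (T n : X →L[ℝ] X) L := by
    intro n
    rw [hT]
    exact (Commute.refl L).sub_left ((Commute.one_left L).smul_left _)
  have hGL : ∀ n, Commute (G n) L := fun n => (hcL n).units_inv_left
  have hGG : ∀ n m, Commute (G n) (G m) := by
    intro n m
    refine Commute.units_inv_right (Commute.units_inv_left ?_)
    rw [hT n, hT m]
    exact ((Commute.refl L).sub_right ((Commute.one_right L).smul_right _)).sub_left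
      ((((Commute.one_left L).sub_right ((Commute.one_right _).smul_right _))).smul_left _)
  have hGLn : ∀ n y, ‖G n (L y)‖ ≤ 2 * ‖y‖ := by
    intro n y
    have : G n (L y) = L (G n y) := DFunLike.congr_fun (hGL n).eq y
    rw [this, hLG]
    linarith [norm_add_le y (δ n • G n y), hGnorm n y]
  -- Resolvent identity `G n - G m = (δ n - δ m) G n G m`: the two factors `L` absorb the two
  -- resolvents, each at cost 2. So the approximations are Cauchy on the range of `L²`, which is
  -- dense.
  have hdiff : ∀ n m y, ‖G n (L (L y)) - G m (L (L y))‖ ≤ 4 * |δ n - δ m| * ‖y‖ := by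
    intro n m y
    have c : ∀ k z, G k (L z) = z + δ k • G k z := fun k z =>
      (DFunLike.congr_fun (hGL k).eq z).trans (hLG k z)
    have key : G n (L (L y)) - G m (L (L y)) = (δ n - δ m) • G n (L (G m (L y))) := by
      have e1 : L y = L (G m (L y)) - δ m • G m (L y) := eq_sub_of_add_eq (hLG m (L y)).symm
      have e2 : G n (L y) = G m (L y) + (δ n - δ m) • G n (G m (L y)) := by
        conv_lhs => rw [e1, map_sub, c n (G m (L y)), map_smul]
        module
      rw [c n (L y), c m (L y), c n (G m (L y)), e2]
      module
    rw [key, norm_smul, Real.norm_eq_abs]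
    have := (hGLn n (G m (L y))).trans (mul_le_mul_of_nonneg_left (hGLn m y) zero_le_two)
    nlinarith [abs_nonneg (δ n - δ m)]
  have hd2 : DenseRange fun y => L (L y) := hd.comp hd L.continuous
  let e : ℕ → ℝ → X := fun n t => NormedSpace.exp (t • G n) x
  have hcauchy : UniformCauchySeqOn e atTop (Icc 0 1) := by
    rw [Metric.uniformCauchySeqOn_iff]
    intro η hη
    obtain ⟨y, hy⟩ := hd2.exists_dist_lt x (show 0 < η / 4 by positivity)
    set z := L (L y)
    have hlim : Tendsto (fun n => 4 * δ n * ‖y‖) atTop (𝓝 0) := by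
      simpa using (hδlim.const_mul 4).mul_const ‖y‖
    obtain ⟨N, hN⟩ := (hlim.eventually_lt_const (show 0 < η / 4 by positivity)).exists_forall_of_atTop
    refine ⟨N, fun n hn m hm t ht => ?_⟩
    have h1 : ∀ k, ‖NormedSpace.exp (t • G k) (x - z)‖ ≤ η / 4 := fun k =>
      (norm_exp_smul_apply_le (hGdiss k) _ ht.1).trans (by rw [← dist_eq_norm]; exact hy.le)
    have h2 : ‖NormedSpace.exp (t • G n) z - NormedSpace.exp (t • G m) z‖ < η / 2 := by
      have a1 := norm_exp_smul_sub_exp_smul_apply_le (hGdiss m) (hGdiss n) (hGG m n) z ht.1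
      have a2 : ‖G n z - G m z‖ * t ≤ ‖G n z - G m z‖ :=
        mul_le_of_le_one_right (norm_nonneg _) ht.2
      have a3 := hdiff n m y
      have a4 : |δ n - δ m| ≤ δ n + δ m := by
        rw [abs_le]; constructor <;> linarith [hδ n, hδ m]
      have a5 := mul_le_mul_of_nonneg_right a4 (norm_nonneg y)
      linarith [hN n hn, hN m hm]
    have h3 : e n t - e m t = NormedSpace.exp (t • G n) (x - z) -
        NormedSpace.exp (t • G m) (x - z) +
        (NormedSpace.exp (t • G n) z - NormedSpace.exp (t • G m) z) := by
      simp only [e, map_sub]; abel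
    rw [dist_eq_norm, h3]
    have h4 := norm_add_le (NormedSpace.exp (t • G n) (x - z) - NormedSpace.exp (t • G m) (x - z))
      (NormedSpace.exp (t • G n) z - NormedSpace.exp (t • G m) z)
    have h5 := norm_sub_le (NormedSpace.exp (t • G n) (x - z)) (NormedSpace.exp (t • G m) (x - z))
    linarith [h1 n, h1 m]
  have hex : ∀ t ∈ Icc (0 : ℝ) 1, ∃ y, Tendsto (fun n => e n t) atTop (𝓝 y) := fun t ht =>
    cauchySeq_tendsto_of_complete (hcauchy.cauchySeq ht)
  choose! S hS using hex
  have hScont : ContinuousOn S (Icc 0 1) :=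
    (hcauchy.tendstoUniformlyOn_of_tendsto hS).continuousOn
      (Eventually.of_forall fun n => (continuous_exp_smul_apply (G n) x).continuousOn).frequently
  have hS0 : S 0 = x := by
    refine tendsto_nhds_unique (hS 0 ⟨le_rfl, zero_le_one⟩) ?_
    simp [e]
  -- A continuous extension to the whole line, so that the fundamental theorem of calculus also
  -- applies at the endpoints.
  let S' : ℝ → X := IccExtend zero_le_one ((Icc (0 : ℝ) 1).domRestrict S)
  have hS'c : Continuous S' := (continuousOn_iff_continuous_domRestrict.1 hScont).Icc_extend'
  have hS'S : ∀ t ∈ Icc (0 : ℝ) 1, S' t = S t := fun t ht => IccExtend_of_mem _ _ ht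
  have hint : ∀ t ∈ Icc (0 : ℝ) 1, L (S t) - L x = ∫ s in (0 : ℝ)..t, S' s := by
    intro t ht
    -- `(L - δ n) (e n)` has derivative `e n`; integrating leaves no unbounded operator when `n →
    -- ∞`.
    have hn : ∀ n, L (e n t) - δ n • e n t - (L x - δ n • x) = ∫ s in (0 : ℝ)..t, e n s := by
      intro n
      have := intervalIntegral.integral_eq_sub_of_hasDerivAt (a := 0) (b := t)
        (f := fun s => (L - δ n • (1 : X →L[ℝ] X)) (e n s)) (f' := e n) (fun s _ => by
          have := (L - δ n • (1 : X →L[ℝ] X)).hasFDerivAt.comp_hasDerivAt s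
            (hasDerivAt_exp_smul_apply (G n) x s)
          rwa [hGT] at this)
        ((continuous_exp_smul_apply (G n) x).intervalIntegrable _ _)
      rw [this]
      simp [e]
    have l1 : Tendsto (fun n => L (e n t) - δ n • e n t - (L x - δ n • x)) atTop
        (𝓝 (L (S t) - (0 : ℝ) • S t - (L x - (0 : ℝ) • x))) :=
      (((L.continuous.tendsto _).comp (hS t ht)).sub (hδlim.smul (hS t ht))).sub
        (tendsto_const_nhds.sub (hδlim.smul_const x))
    have l2 : Tendsto (fun n => ∫ s in (0 : ℝ)..t, e n s) atTop (𝓝 (∫ s in (0 : ℝ)..t, S' s)) := by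
      have hsub : ∀ s ∈ uIoc (0 : ℝ) t, s ∈ Icc (0 : ℝ) 1 := by
        intro s hs
        rw [uIoc_of_le ht.1] at hs
        exact ⟨hs.1.le, hs.2.trans ht.2⟩
      refine intervalIntegral.tendsto_integral_filter_of_dominated_convergence (fun _ => ‖x‖)
        (Eventually.of_forall fun n =>
          (continuous_exp_smul_apply (G n) x).aestronglyMeasurable)
        (Eventually.of_forall fun n => Eventually.of_forall fun s hs =>
          norm_exp_smul_apply_le (hGdiss n) x (hsub s hs).1)
        intervalIntegrable_const (Eventually.of_forall fun s hs => ?_)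
      rw [hS'S s (hsub s hs)]
      exact hS s (hsub s hs)
    have := tendsto_nhds_unique (l1.congr hn) l2
    simpa using this
  refine ⟨S, hScont, hS0, fun t ht => ?_⟩
  have hder : HasDerivAt (fun r => L x + ∫ s in (0 : ℝ)..r, S' s) (S' t) t :=
    (hS'c.integral_hasStrictDerivAt 0 t).hasDerivAt.const_add _
  rw [hS'S t ht] at hder
  refine hder.hasDerivWithinAt.congr (fun s hs => ?_) ?_
  · rw [← hint s hs]; abel
  · rw [← hint t ht]; abel

end Semigroup

end QuasiReversibility


namespace QuasiReversibility

/-! ### Bounded perturbations of a skew-adjoint generator. -/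

section Perturbation

variable {X : Type*} [NormedAddCommGroup X] [InnerProductSpace ℝ X] [CompleteSpace X]

/-- If `K` is the bounded inverse of a skew-adjoint operator, the evolution equation for the
generator `K⁻¹ + F`, multiplied by `K`, is solvable for every bounded perturbation `F`. -/
theorem exists_hasDerivWithinAt_of_skew (K F : X →L[ℝ] X) (hK : ∀ x, inner ℝ (K x) x = 0)
    (hd : DenseRange K) (x : X) : ∃ U : ℝ → X, ContinuousOn U (Icc 0 1) ∧ U 0 = x ∧
      ∀ t ∈ Icc (0 : ℝ) 1,
        HasDerivWithinAt (fun s => K (U s)) (U t + K (F (U t))) (Icc 0 1) t := by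
  -- A shift exceeding `‖F‖` gives both `‖R * F‖ < 1` and dissipativity of `L`.
  obtain ⟨r, hr⟩ : ∃ r : ℝ, r = ‖F‖ + 1 := ⟨_, rfl⟩
  have hr0 : 0 < r := by rw [hr]; positivity
  have hA : IsUnit (1 - r • K) := by
    refine ContinuousLinearMap.isUnit_of_forall_le_norm_inner_map _ (c := 1) one_pos fun y => ?_
    simp [inner_sub_left, real_inner_smul_left, hK]
  obtain ⟨A, hA⟩ := hA
  -- Formally `R = (K⁻¹ - r)⁻¹`; skewness gives the resolvent bound `1 / r`.
  let R : X →L[ℝ] X := (A⁻¹ : (X →L[ℝ] X)ˣ) * K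
  have hAR : (A : X →L[ℝ] X) * R = K := A.mul_inv_cancel_left K
  have hR : ‖R‖ ≤ r⁻¹ := by
    refine ContinuousLinearMap.opNorm_le_bound _ (by positivity) fun y => ?_
    have h1 : R y - r • K (R y) = K y := by
      have := DFunLike.congr_fun hAR y
      rw [hA] at this
      simpa using this
    have h2 : R y = K (y + r • R y) := by
      rw [map_add, map_smul, ← h1]; abel
    have h3 : inner ℝ (R y) y + r * ‖R y‖ ^ 2 = 0 := by
      have := hK (y + r • R y)
      rwa [← h2, inner_add_right, real_inner_smul_right, real_inner_self_eq_norm_sq] at this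
    have h4 := abs_real_inner_le_norm (R y) y
    have h5 := neg_abs_le (inner ℝ (R y) y)
    rw [inv_mul_eq_div, le_div_iff₀ hr0]
    by_cases h0 : ‖R y‖ = 0
    · simp [h0]
    · have : 0 < ‖R y‖ := lt_of_le_of_ne (norm_nonneg _) (Ne.symm h0)
      nlinarith
  have hRF : IsUnit (1 + R * F) := by
    have : ‖-(R * F)‖ < 1 := by
      rw [norm_neg]
      refine (norm_mul_le _ _).trans_lt ?_
      have h1 := mul_le_mul_of_nonneg_right hR (norm_nonneg F)
      refine h1.trans_lt ?_
      rw [inv_mul_eq_div, div_lt_one hr0, hr]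
      linarith
    simpa using isUnit_one_sub_of_norm_lt_one this
  obtain ⟨Q, hQ⟩ := hRF
  obtain ⟨T, hTdef⟩ : ∃ T : (X →L[ℝ] X)ˣ, T = A * Q := ⟨_, rfl⟩
  have hT : (T : X →L[ℝ] X) = 1 - r • K + K * F := by
    rw [hTdef, Units.val_mul, hQ, mul_add, mul_one, ← mul_assoc, hAR, hA]
  -- Formally `L = (K⁻¹ + F - r)⁻¹`, since `T = K (K⁻¹ + F - r)`.
  let L : X →L[ℝ] X := (T⁻¹ : (X →L[ℝ] X)ˣ) * K
  have hTL : ∀ y, L y - r • K (L y) + K (F (L y)) = K y := by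
    intro y
    have := DFunLike.congr_fun (T.mul_inv_cancel_left K) y
    rw [hT] at this
    exact this
  have hLdiss : ∀ y, inner ℝ (L y) y ≤ 0 := by
    intro y
    have h1 : L y = K (y + r • L y - F (L y)) := by
      rw [map_sub, map_add, map_smul, ← hTL]; abel
    have h2 := hK (y + r • L y - F (L y))
    rw [← h1, inner_sub_right, inner_add_right, real_inner_smul_right,
      real_inner_self_eq_norm_sq] at h2
    have h3 := real_inner_le_norm (L y) (F (L y))
    have h4 := F.le_opNorm (L y)
    nlinarith [norm_nonneg (L y), sq_nonneg ‖L y‖,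
      mul_le_mul_of_nonneg_left h4 (norm_nonneg (L y))]
  have hLd : DenseRange L := by
    have hs : Function.Surjective ((T⁻¹ : (X →L[ℝ] X)ˣ) : X →L[ℝ] X) := fun y =>
      ⟨(T : X →L[ℝ] X) y, DFunLike.congr_fun T.inv_mul y⟩
    exact hs.denseRange.comp hd (ContinuousLinearMap.continuous _)
  obtain ⟨S, hSc, hS0, hS⟩ := exists_hasDerivWithinAt_of_dissipative L hLdiss hLd x
  refine ⟨fun t => Real.exp (r * t) • S t,
    (Continuous.continuousOn (by fun_prop)).smul hSc, by simp [hS0], fun t ht => ?_⟩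
  have hexp : HasDerivAt (fun s => Real.exp (r * s)) (r * Real.exp (r * t)) t := by
    simpa [mul_comm] using ((hasDerivAt_id t).const_mul r).exp
  have h1 := hexp.hasDerivWithinAt.smul (hS t ht)
  -- Applying `T` turns `L S` into `K S`; the term `r K S` from differentiating the exponential
  -- cancels the `-r K` in `T`.
  have h2 := (T : X →L[ℝ] X).hasFDerivAt.comp_hasDerivWithinAt t h1
  have hTL' : ∀ y, (T : X →L[ℝ] X) (L y) = K y := fun y =>
    DFunLike.congr_fun (T.mul_inv_cancel_left K) y
  convert h2 using 1
  · funext s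
    simp [hTL']
  · simp only [map_add, map_smul, hTL']
    simp only [hT, add_apply, sub_apply, one_apply_eq_self, smul_apply, mul_apply_eq_comp]
    module

end Perturbation

/-! ### The abstract second-order equation. -/

section WaveEquation

variable {V H : Type*} [NormedAddCommGroup V] [InnerProductSpace ℝ V] [CompleteSpace V]
  [NormedAddCommGroup H] [InnerProductSpace ℝ H] [CompleteSpace H]

/-- With `V` identified with its dual by Riesz, the wave generator is `(u, v) ↦ (v, -u)` read
through `J`. Its inverse `K (a, b) = (-J* b, J a)` is skew, and has dense range because `J` has
dense range and is injective. -/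
lemma exists_adjoint_wave_solution (J B : V →L[ℝ] H) (hJ : Function.Injective J) (hJd : DenseRange J)
    (u₀ : V) : ∃ (u : ℝ → V) (v : ℝ → H), ContinuousOn u (Icc 0 1) ∧ ContinuousOn v (Icc 0 1) ∧
      u 0 = u₀ ∧ v 0 = 0 ∧
      (∀ t ∈ Icc (0 : ℝ) 1, HasDerivWithinAt (fun s => J (u s)) (v t) (Icc 0 1) t) ∧
      ∀ t ∈ Icc (0 : ℝ) 1, HasDerivWithinAt (fun s => J.adjoint (v s))
        (-(u t + J.adjoint (B (u t)))) (Icc 0 1) t := by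
  let E := WithLp.prodContinuousLinearEquiv 2 ℝ V H
  let p := WithLp.fstL 2 ℝ V H
  let q := WithLp.sndL 2 ℝ V H
  let K : WithLp 2 (V × H) →L[ℝ] WithLp 2 (V × H) :=
    (E.symm : V × H →L[ℝ] WithLp 2 (V × H)).comp ((-(J.adjoint.comp q)).prod (J.comp p))
  let F : WithLp 2 (V × H) →L[ℝ] WithLp 2 (V × H) :=
    (E.symm : V × H →L[ℝ] WithLp 2 (V × H)).comp ((0 : _ →L[ℝ] V).prod (-(B.comp p)))
  have hK : ∀ x, inner ℝ (K x) x = 0 := by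
    intro x
    have : inner ℝ (K x) x = inner ℝ (-(J.adjoint (q x))) (p x) + inner ℝ (J (p x)) (q x) := rfl
    rw [this, inner_neg_left, ContinuousLinearMap.adjoint_inner_left, real_inner_comm]
    ring
  have hadj : DenseRange J.adjoint := by
    change Dense (J.adjoint.range : Set V)
    rw [Submodule.dense_iff_topologicalClosure_eq_top,
      Submodule.topologicalClosure_eq_top_iff, Submodule.eq_bot_iff]
    intro y hy
    refine hJ ?_
    rw [map_zero, ← inner_self_eq_zero (𝕜 := ℝ), ← ContinuousLinearMap.adjoint_inner_left]
    exact hy _ ⟨_, rfl⟩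
  have hKd : DenseRange K := by
    have h1 : DenseRange (Prod.map (fun h => -J.adjoint h) J) := by
      refine DenseRange.prodMap ?_ hJd
      exact neg_surjective.denseRange.comp hadj continuous_neg
    have h2 : DenseRange (E.symm ∘ Prod.map (fun h => -J.adjoint h) J) :=
      E.symm.surjective.denseRange.comp h1 E.symm.continuous
    refine h2.mono ?_
    rintro _ ⟨⟨h, v⟩, rfl⟩
    exact ⟨E.symm (v, h), rfl⟩
  obtain ⟨U, hUc, hU0, hU⟩ := exists_hasDerivWithinAt_of_skew K F hK hKd (E.symm (u₀, 0))
  refine ⟨fun t => p (U t), fun t => q (U t), p.continuous.comp_continuousOn hUc,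
    q.continuous.comp_continuousOn hUc, congrArg p hU0, congrArg q hU0, fun t ht => ?_,
    fun t ht => ?_⟩
  · have h := q.hasFDerivAt.comp_hasDerivWithinAt t (hU t ht)
    have e : q (U t + K (F (U t))) = q (U t) + J 0 := rfl
    rw [e, map_zero, add_zero] at h
    exact h
  · have h := (p.hasFDerivAt.comp_hasDerivWithinAt t (hU t ht)).neg
    have e : -p (U t + K (F (U t))) = -(p (U t) + -J.adjoint (-B (p (U t)))) := rfl
    rw [e, map_neg, neg_neg] at h
    refine h.congr (fun s _ => ?_) ?_ <;> exact (neg_neg _).symm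

/-- The abstract wave equation `u'' + A u + B u = 0`, where `A : V → V'` is the Riesz isomorphism
and `J : V → H` is an injective map with dense range; here `v = u'` and `w = u''`. -/
theorem exists_wave_solution (J B : V →L[ℝ] H) (hJ : Function.Injective J) (hJd : DenseRange J)
    (u₀ : V) : ∃ (u : ℝ → V) (v : ℝ → H) (w : ℝ → StrongDual ℝ V),
      ContinuousOn u (Icc 0 1) ∧ ContinuousOn v (Icc 0 1) ∧ ContinuousOn w (Icc 0 1) ∧
      u 0 = u₀ ∧ v 0 = 0 ∧
      (∀ t ∈ Icc (0 : ℝ) 1, HasDerivWithinAt (fun s => J (u s)) (v t) (Icc 0 1) t) ∧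
      (∀ t ∈ Icc (0 : ℝ) 1,
        HasDerivWithinAt (fun s => (innerSL ℝ (v s)).comp J) (w t) (Icc 0 1) t) ∧
      ∀ t ψ, w t ψ + inner ℝ (u t) ψ + inner ℝ (B (u t)) (J ψ) = 0 := by
  obtain ⟨u, v, huc, hvc, hu0, hv0, hu, hv⟩ := exists_adjoint_wave_solution J B hJ hJd u₀
  let W : V →L[ℝ] V := -(ContinuousLinearMap.id ℝ V + J.adjoint.comp B)
  refine ⟨u, v, fun x => innerSL ℝ (W (u x)), huc, hvc,
    (innerSL ℝ).continuous.comp_continuousOn (W.continuous.comp_continuousOn huc), hu0, hv0, hu,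
    fun t ht => ?_, fun t ψ => ?_⟩
  -- The functional `ψ ↦ ⟨f, J ψ⟩` has Riesz representative `J* f`, so the derivative in `V`
  -- transfers to the dual.
  · have e : ∀ f : H, (innerSL ℝ f).comp J = innerSL ℝ (J.adjoint f) := by
      intro f
      ext ψ
      exact (ContinuousLinearMap.adjoint_inner_left J ψ f).symm
    simp only [e]
    exact (innerSL ℝ : V →L[ℝ] StrongDual ℝ V).hasFDerivAt.comp_hasDerivWithinAt t (hv t ht)
  · have e : innerSL ℝ (W (u t)) ψ = inner ℝ (-(u t + J.adjoint (B (u t)))) ψ := rfl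
    rw [e, inner_neg_left, inner_add_left, ContinuousLinearMap.adjoint_inner_left]
    ring

end WaveEquation

end QuasiReversibility


namespace QuasiReversibility

/-! ### Sobolev spaces on the interval and the weak formulation. -/

section Sobolev

lemma IsTest.eq_zero {φ : ℝ → ℝ} (hφ : IsTest φ) {t : ℝ} (ht : t ∉ Ioo (0 : ℝ) 1) : φ t = 0 :=
  image_eq_zero_of_notMem_tsupport fun h => ht (hφ.supp h)

lemma IsTest.memLp {φ : ℝ → ℝ} (hφ : IsTest φ) :
    MemLp φ 2 (volume.restrict (Ioo (0 : ℝ) 1)) :=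
  (hφ.smooth.continuous.memLp_of_hasCompactSupport hφ.compact).restrict _

lemma IsTest.deriv {φ : ℝ → ℝ} (hφ : IsTest φ) : IsTest (deriv φ) where
  smooth := (contDiff_infty_iff_deriv.1 hφ.smooth).2
  compact := hφ.compact.deriv
  supp := (tsupport_deriv_subset (𝕜 := ℝ)).trans hφ.supp

/-- A continuously differentiable function on `[0,1]` is weakly differentiable. -/
lemma hasWeakDeriv_of_hasDerivWithinAt {E : Type*} [NormedAddCommGroup E] [NormedSpace ℝ E]
    [CompleteSpace E] {f f' : ℝ → E}
    (hf : ∀ t ∈ Icc (0 : ℝ) 1, HasDerivWithinAt f (f' t) (Icc 0 1) t)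
    (hf' : ContinuousOn f' (Icc 0 1)) : HasWeakDeriv f f' := by
  intro φ hφ
  have hfc : ContinuousOn f (Icc 0 1) := fun t ht => (hf t ht).continuousWithinAt
  have hφd : ∀ t, HasDerivAt φ (deriv φ t) t := fun t =>
    (hφ.smooth.differentiable (by simp) t).hasDerivAt
  have c1 : ContinuousOn (fun t => deriv φ t • f t) (Icc 0 1) :=
    hφ.deriv.smooth.continuous.continuousOn.smul hfc
  have c2 : ContinuousOn (fun t => φ t • f' t) (Icc 0 1) :=
    hφ.smooth.continuous.continuousOn.smul hf'
  have i1 : IntervalIntegrable (fun t => deriv φ t • f t) volume 0 1 :=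
    c1.intervalIntegrable_of_Icc zero_le_one
  have i2 : IntervalIntegrable (fun t => φ t • f' t) volume 0 1 :=
    c2.intervalIntegrable_of_Icc zero_le_one
  have key := intervalIntegral.integral_eq_sub_of_hasDeriv_right_of_le (zero_le_one (α := ℝ))
    (hφ.smooth.continuous.continuousOn.smul hfc) (f' := fun t => φ t • f' t + deriv φ t • f t)
    (fun t ht => ((hφd t).hasDerivWithinAt.smul
      ((hf t (Ioo_subset_Icc_self ht)).hasDerivAt (Icc_mem_nhds ht.1 ht.2)).hasDerivWithinAt))
    (i2.add i1)
  have z0 : φ 0 = 0 := hφ.eq_zero (by simp)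
  have z1 : φ 1 = 0 := hφ.eq_zero (by simp)
  rw [intervalIntegral.integral_add i2 i1] at key
  simp only [Pi.smul_apply', z0, z1, zero_smul, sub_zero] at key
  rw [intervalIntegral.integral_of_le zero_le_one, intervalIntegral.integral_of_le zero_le_one,
    integral_Ioc_eq_integral_Ioo, integral_Ioc_eq_integral_Ioo] at key
  exact eq_neg_of_add_eq_zero_right key

lemma integral_smul_eq_inner {φ : ℝ → ℝ} (hφ : IsTest φ) (f : L2) :
    ∫ t in Ioo (0 : ℝ) 1, φ t • f t = inner ℝ (hφ.memLp.toLp φ) f := by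
  rw [L2.inner_def]
  refine integral_congr_ae ?_
  filter_upwards [hφ.memLp.coeFn_toLp] with t ht
  rw [ht, smul_eq_mul, mul_comm]
  rfl

lemma eq_zero_of_integral_smul_eq_zero (f : L2)
    (h : ∀ φ : ℝ → ℝ, IsTest φ → ∫ t in Ioo (0 : ℝ) 1, φ t • f t = 0) : f = 0 := by
  have hf : Integrable f (volume.restrict (Ioo (0 : ℝ) 1)) :=
    (Lp.memLp f).integrable (by norm_num)
  have := isOpen_Ioo.ae_eq_zero_of_integral_contDiff_smul_eq_zero
    (hf.locallyIntegrable.locallyIntegrableOn _) fun φ h1 h2 h3 => h φ ⟨h1, h2, h3⟩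
  rw [Lp.eq_zero_iff_ae_eq_zero]
  filter_upwards [this, ae_restrict_mem measurableSet_Ioo] with t h1 h2 using h1 h2

/-- Each test function imposes an equality of two continuous functionals. Closedness yields the
completeness needed for adjoints and the Riesz isomorphism. -/
lemma isClosed_H1 : IsClosed (H1 : Set (WithLp 2 (L2 × L2))) := by
  have : (H1 : Set (WithLp 2 (L2 × L2))) = ⋂ (φ : ℝ → ℝ) (hφ : IsTest φ),
      {u | inner ℝ (hφ.deriv.memLp.toLp _) u.fst = -inner ℝ (hφ.memLp.toLp φ) u.snd} := by
    ext u
    refine Iff.trans (forall₂_congr fun φ hφ => ?_) mem_iInter₂.symm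
    rw [integral_smul_eq_inner hφ, integral_smul_eq_inner hφ.deriv]
    rfl
  rw [this]
  refine isClosed_iInter fun φ => isClosed_iInter fun hφ => isClosed_eq ?_ ?_
  · exact continuous_const.inner (WithLp.fstL 2 ℝ L2 L2).continuous
  · exact (continuous_const.inner (WithLp.sndL 2 ℝ L2 L2).continuous).neg

instance : CompleteSpace H1 := isClosed_H1.completeSpace_coe

instance : CompleteSpace H10 :=
  testSubmodule.isClosed_topologicalClosure.completeSpace_coe

lemma IsTest.hasWeakDeriv_toLp {φ : ℝ → ℝ} (hφ : IsTest φ) :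
    HasWeakDeriv (hφ.memLp.toLp φ : ℝ → ℝ) (hφ.deriv.memLp.toLp (_root_.deriv φ) : ℝ → ℝ) := by
  intro ψ hψ
  have h := hasWeakDeriv_of_hasDerivWithinAt (f := φ) (f' := _root_.deriv φ)
    (fun t _ => (hφ.smooth.differentiable (by simp) t).hasDerivAt.hasDerivWithinAt)
    hφ.deriv.smooth.continuous.continuousOn ψ hψ
  have e1 : ∫ t in Ioo (0 : ℝ) 1, _root_.deriv ψ t • (hφ.memLp.toLp φ : ℝ → ℝ) t =
      ∫ t in Ioo (0 : ℝ) 1, _root_.deriv ψ t • φ t := by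
    refine integral_congr_ae ?_
    filter_upwards [hφ.memLp.coeFn_toLp] with t ht
    rw [ht]
  have e2 : ∫ t in Ioo (0 : ℝ) 1, ψ t • (hφ.deriv.memLp.toLp (_root_.deriv φ) : ℝ → ℝ) t =
      ∫ t in Ioo (0 : ℝ) 1, ψ t • _root_.deriv φ t := by
    refine integral_congr_ae ?_
    filter_upwards [hφ.deriv.memLp.coeFn_toLp] with t ht
    rw [ht]
  rw [e1, e2, h]

lemma exists_toL2_eq_of_isTest {φ : ℝ → ℝ} (hφ : IsTest φ) :
    ∃ u : H10, toL2 u = hφ.memLp.toLp φ :=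
  ⟨⟨⟨WithLp.toLp 2 (hφ.memLp.toLp φ, hφ.deriv.memLp.toLp _), hφ.hasWeakDeriv_toLp⟩,
    testSubmodule.le_topologicalClosure ⟨φ, hφ, hφ.memLp.coeFn_toLp⟩⟩, rfl⟩

/-- The weak derivative of zero is orthogonal to all test functions, hence zero. -/
lemma toL2_injective : Function.Injective toL2 := by
  rw [injective_iff_map_eq_zero]
  intro u hu
  have hu1 : u.1.1.fst = 0 := hu
  have hu2 : u.1.1.snd = 0 := by
    refine eq_zero_of_integral_smul_eq_zero _ fun φ hφ => ?_
    have h := u.1.2 φ hφ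
    rw [integral_smul_eq_inner hφ.deriv, hu1, inner_zero_right] at h
    linarith
  exact Subtype.ext (Subtype.ext (congrArg (WithLp.toLp 2) (Prod.ext hu1 hu2)))

lemma denseRange_toL2 : DenseRange toL2 := by
  change Dense (toL2.range : Set L2)
  rw [Submodule.dense_iff_topologicalClosure_eq_top, Submodule.topologicalClosure_eq_top_iff,
    Submodule.eq_bot_iff]
  intro f hf
  refine eq_zero_of_integral_smul_eq_zero f fun φ hφ => ?_
  rw [integral_smul_eq_inner hφ]
  exact hf _ (exists_toL2_eq_of_isTest hφ)

lemma inner_H10_eq (u ψ : H10) :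
    inner ℝ u ψ = inner ℝ (toL2 u) (toL2 ψ) + inner ℝ (dy u) (dy ψ) := rfl

/-- The regularized problem has a weak solution for every bounded perturbation. -/
theorem exists_isWeakSolution (P : H1 →L[ℝ] L2) (u₀ : H10) :
    ∃ u : ℝ → H10, IsWeakSolution (P : H1 →ₗ[ℝ] L2) u₀ u := by
  -- The inner product of `H10` contains an extra `L2` term, which subtracting `toL2` compensates.
  let B : H10 →L[ℝ] L2 := P.comp H10.subtypeL - toL2
  have hex := exists_wave_solution (V := H10) (H := L2) toL2 B toL2_injective
  obtain ⟨u, v, w, huc, hvc, hwc, hu0, hv0, hu, hv, hw⟩ := hex denseRange_toL2 u₀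
  refine ⟨u, huc, v, w, ⟨hvc, hu⟩, ?_, ?_,
    fun ψ => Eventually.of_forall fun x => ?_,
    congrArg Subtype.val hu0, hv0⟩
  · obtain ⟨C, hC⟩ := isCompact_Icc.exists_bound_of_continuousOn hwc
    refine MemLp.of_bound ((hwc.mono Ioo_subset_Icc_self).aestronglyMeasurable measurableSet_Ioo) C ?_
    filter_upwards [ae_restrict_mem measurableSet_Ioo] with t ht
    exact hC t (Ioo_subset_Icc_self ht)
  · have hv' : ∀ t ∈ Icc (0 : ℝ) 1,
        HasDerivWithinAt (fun x => L2toHneg1 (v x)) (w t) (Icc 0 1) t := hv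
    have := hasWeakDeriv_of_hasDerivWithinAt (E := Hneg1) hv' hwc
    exact this
  · have h := hw x ψ
    have e : B (u x) = P (u x) - toL2 (u x) := rfl
    rw [e, inner_sub_left, inner_H10_eq] at h
    rw [ContinuousLinearMap.coe_coe]
    linarith

end Sobolev

end QuasiReversibility

theorem theorem3p3
    (β γ : ℝ → ℝ)
    (hβ : ∀ ε ∈ Ioo (0 : ℝ) 1, β ε ∈ Ioo (0 : ℝ) 1)
    (hβ_lim : Tendsto β (𝓝[>] 0) (𝓝 0))
    (hγ : ∀ b ∈ Ioo (0 : ℝ) 1, 1 ≤ γ b)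
    (hγ_lim : Tendsto γ (𝓝[>] 0) atTop)
    (P : ℝ → QuasiReversibility.H1 →ₗ[ℝ] QuasiReversibility.L2)
    (C₁ : ℝ) (hC₁ : 0 < C₁)
    (hP : ∀ ε ∈ Ioo (0 : ℝ) 1, QuasiReversibility.IsStabilized C₁ (γ (β ε)) (P ε))
    (u₀ : QuasiReversibility.H1) (u₀ε : ℝ → QuasiReversibility.H1)
    (hu₀ε : ∀ ε ∈ Ioo (0 : ℝ) 1, u₀ε ε ∈ QuasiReversibility.H10)
    (hnoise : ∀ ε ∈ Ioo (0 : ℝ) 1, ‖u₀ε ε - u₀‖ ≤ ε) :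
    ∀ ε ∈ Ioo (0 : ℝ) 1, ∃ u : ℝ → QuasiReversibility.H10,
      QuasiReversibility.IsWeakSolution (P ε) (u₀ε ε) u ∧
      ContinuousOn u (Icc 0 1) ∧
      ∃ v : ℝ → QuasiReversibility.L2, QuasiReversibility.IsDx u v := by
  intro ε hε
  let Q : QuasiReversibility.H1 →L[ℝ] QuasiReversibility.L2 :=
    (P ε).mkContinuous (C₁ * Real.log (γ (β ε))) (hP ε hε)
  obtain ⟨u, hu⟩ := QuasiReversibility.exists_isWeakSolution Q ⟨u₀ε ε, hu₀ε ε hε⟩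
  have hu' : QuasiReversibility.IsWeakSolution (P ε) (u₀ε ε) u := hu
  obtain ⟨huc, v, w, hv, -⟩ := hu
  exact ⟨u, hu', huc, v, hv⟩
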